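/- Fix a lattice dimension $D$, a local dimension $d$, an interaction range $r$, an interaction strength $J$, and constants $0<c_1$, $c_2$, $0<a$, $b$, $0<g$. There is a constant $C$, depending only on these data, such that the following holds for every $n\ge 1$, with $N=n^D$. Let $\Lambda=\{1,\dots,n\}^D$ and let $H=\sum_{i\in\Lambda}H_i$ on $(\mathbb C^d)^{\otimes\Lambda}$, where each $H_i$ is self-adjoint, acts only on sites at (coordinatewise) distance at most $r$ from $i$, and satisfies $\|H_i\|\le J$. Let $M_{\ge E}$ be the number of eigenstates of $H$, counted with multiplicity, of energy at least $E$, and assume the spectral decay $$M_{\ge E+t\sqrt N}\le \frac1{t^3}\,M_{\ge E}\qquad\text{for all } t>0 \text{ and all } E \text{ with } c_1N\le E\le c_2N .$$ Let $|\psi\rangle$ be a normalized pure product state with $\langle\psi|H|\psi\rangle=\eta N$ and $c_1\le\eta\le c_2$. Let $\delta$ satisfy $a/\sqrt N\le\delta\le b/\sqrt N$, let $K\ge1$ be an integer, put $\eta'=\eta-K\delta$, and assume $|\eta-\eta'|^2\ge g\,\log(\sqrt N)/\sqrt N$. Divide the energy axis into the windows $$M_0=[(\eta-\delta)N,\infty),\qquad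 M_k=[(\eta-(k+1)\delta)N,(\eta-k\delta)N)\ \ (0<k<K),\qquad M_K=(-\infty,\eta'N),$$ let $\mathcal M_k$ be the span of the eigenvectors of $H$ with energy in $M_k$, so that the Hilbert space is $\bigoplus_{k=0}^K\mathcal M_k$, and let $U=\bigoplus_{k=0}^K U_k$, where the $U_k$ are independent and each $U_k$ is Haar distributed on the unitary group of $\mathcal M_k$. Then $$\bigl|\,\mathbb E_U\langle\psi|U^\dagger HU|\psi\rangle-\langle\psi|H|\psi\rangle\,\bigr|\le C\sqrt N .$$ -/

import Mathlib

open MeasureTheory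

noncomputable section

/-- The sites of the lattice `{1, …, n}^D`. -/
abbrev Site (D n : ℕ) : Type := Fin D → Fin n

/-- The Hilbert space `⨂_{i ∈ Λ} ℂ^d` of the lattice `Λ = {1, …, n}^D`, written in the
computational basis, which is indexed by the configurations `s : Λ → {1, …, d}`. -/
abbrev LatticeSpace (D n d : ℕ) : Type := EuclideanSpace ℂ (Site D n → Fin d)

/-- Operators on the lattice Hilbert space; `‖A‖` is the operator norm. -/
abbrev LatticeOp (D n d : ℕ) : Type := LatticeSpace D n d →L[ℂ] LatticeSpace D n d

/-- The matrix element `⟨s|A|t⟩` in the computational basis. -/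
def matrixElement {D n d : ℕ} (A : LatticeOp D n d) (s t : Site D n → Fin d) : ℂ :=
  A (EuclideanSpace.single t 1) s

/-- `A` acts only on the sites of `X`: `A = B ⊗ 𝟙` with `B` an operator on `⨂_{i ∈ X} ℂ^d`. -/
def ActsOn {D n d : ℕ} (X : Set (Site D n)) (A : LatticeOp D n d) : Prop :=
  ∃ B : Matrix (X → Fin d) (X → Fin d) ℂ, ∀ s t : Site D n → Fin d,
    ((∀ i, i ∉ X → s i = t i) → matrixElement A s t = B (fun i => s i) (fun i => t i)) ∧
    ((∃ i, i ∉ X ∧ s i ≠ t i) → matrixElement A s t = 0)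

/-- The sites at (coordinatewise) distance at most `r` from `i`. -/
def siteBall {D n : ℕ} (r : ℕ) (i : Site D n) : Set (Site D n) :=
  {j | ∀ a : Fin D, |((i a : ℕ) : ℤ) - ((j a : ℕ) : ℤ)| ≤ (r : ℤ)}

/-- `(h i)_i` are the terms of a local Hamiltonian `H = ∑ i, h i` of range `r` and
interaction strength `J`. -/
structure IsLocalHamiltonian {D n d : ℕ} (r : ℕ) (J : ℝ) (h : Site D n → LatticeOp D n d) :
    Prop where
  selfAdjoint : ∀ i, IsSelfAdjoint (h i)
  actsOn : ∀ i, ActsOn (siteBall r i) (h i)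
  norm_le : ∀ i, ‖h i‖ ≤ J

/-- `ψ = ⨂_i φ_i` with unit vectors `φ_i ∈ ℂ^d`. -/
def IsProductState {D n d : ℕ} (ψ : LatticeSpace D n d) : Prop :=
  ∃ φ : Site D n → EuclideanSpace ℂ (Fin d), (∀ i, ‖φ i‖ = 1) ∧
    ∀ s : Site D n → Fin d, ψ s = ∏ i, φ i (s i)

/-- The expectation value `⟨v|A|v⟩` (real, as `A` is self-adjoint wherever this is used). -/
def energy {V : Type*} [NormedAddCommGroup V] [InnerProductSpace ℂ V] (A : V →L[ℂ] V) (v : V) :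
    ℝ := (inner ℂ v (A v)).re

/-- The span of the eigenvectors of `A` whose eigenvalue (energy) lies in `S`. -/
def spectralSubspace {V : Type*} [NormedAddCommGroup V] [InnerProductSpace ℂ V]
    (A : V →L[ℂ] V) (S : Set ℝ) : Submodule ℂ V :=
  Submodule.span ℂ {v | ∃ E ∈ S, A v = (E : ℂ) • v}

instance spectralSubspace_complete {V : Type*} [NormedAddCommGroup V] [InnerProductSpace ℂ V]
    [FiniteDimensional ℂ V] (A : V →L[ℂ] V) (S : Set ℝ) : CompleteSpace (spectralSubspace A S) :=
  FiniteDimensional.complete ℂ _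

/-- The number of eigenstates of `A`, with multiplicity, of energy at least `E`. -/
def numEigenstatesGE {V : Type*} [NormedAddCommGroup V] [InnerProductSpace ℂ V]
    (A : V →L[ℂ] V) (E : ℝ) : ℕ :=
  Module.finrank ℂ (spectralSubspace A (Set.Ici E))

/-- Spectral decay: at every energy `E` with `c₁ N ≤ E ≤ c₂ N`, the number of eigenstates above
`E + t √N` is at most `t⁻³` times the number of those above `E`. -/
def SpectralDecay {V : Type*} [NormedAddCommGroup V] [InnerProductSpace ℂ V]
    (c₁ c₂ N : ℝ) (A : V →L[ℂ] V) : Prop :=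
  ∀ E : ℝ, c₁ * N ≤ E → E ≤ c₂ * N → ∀ t : ℝ, 0 < t →
    (numEigenstatesGE A (E + t * √N) : ℝ) ≤ 1 / t ^ 3 * (numEigenstatesGE A E : ℝ)

/-- The energy windows `M₀ = [(η - δ)N, ∞)`, `M_k = [(η - (k+1)δ)N, (η - kδ)N)` for `0 < k < K`,
and `M_K = (-∞, η' N)`. -/
def energyWindow (N η η' δ : ℝ) (K : ℕ) (k : Fin (K + 1)) : Set ℝ :=
  if (k : ℕ) = 0 then Set.Ici ((η - δ) * N)
  else if (k : ℕ) = K then Set.Iio (η' * N)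
  else Set.Ico ((η - ((k : ℕ) + 1) * δ) * N) ((η - (k : ℕ) * δ) * N)

/-- The group of unitary operators on `V`. -/
abbrev UnitaryOp (V : Type*) [NormedAddCommGroup V] [InnerProductSpace ℂ V] [CompleteSpace V] :
    Type _ := unitary (V →L[ℂ] V)

instance unitaryOp_compact (V : Type*) [NormedAddCommGroup V] [InnerProductSpace ℂ V]
    [CompleteSpace V] [FiniteDimensional ℂ V] : CompactSpace (UnitaryOp V) := by
  have : ProperSpace (V →L[ℂ] V) := FiniteDimensional.proper ℂ _
  refine isCompact_iff_compactSpace.mp ?_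
  refine Metric.isCompact_of_isClosed_isBounded ?_ ?_
  · have : ((unitary (V →L[ℂ] V) : Submonoid (V →L[ℂ] V)) : Set (V →L[ℂ] V)) =
        {A | star A * A = 1} ∩ {A | A * star A = 1} := by
      ext A; simp [Unitary.mem_iff]
    rw [this]
    exact (isClosed_eq (by fun_prop) continuous_const).inter
      (isClosed_eq (by fun_prop) continuous_const)
  · refine (Metric.isBounded_closedBall (x := (0 : V →L[ℂ] V)) (r := 1)).subset ?_
    intro A hA
    rw [mem_closedBall_zero_iff]
    have h1 : ‖A‖ * ‖A‖ ≤ 1 := by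
      rw [← CStarRing.norm_star_mul_self, (Unitary.mem_iff.mp hA).1]
      exact ContinuousLinearMap.norm_id_le
    nlinarith [norm_nonneg A]

/-- The Haar probability measure on the unitary group of a finite-dimensional Hilbert space. -/
def haarUnitary (V : Type*) [NormedAddCommGroup V] [InnerProductSpace ℂ V] [CompleteSpace V]
    [FiniteDimensional ℂ V] : Measure (UnitaryOp V) :=
  Measure.haarMeasure ⊤

instance haarUnitary_isProbabilityMeasure (V : Type*) [NormedAddCommGroup V]
    [InnerProductSpace ℂ V] [CompleteSpace V] [FiniteDimensional ℂ V] :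
    IsProbabilityMeasure (haarUnitary V) :=
  ⟨by simpa [haarUnitary] using
    Measure.haarMeasure_self (K₀ := (⊤ : TopologicalSpace.PositiveCompacts (UnitaryOp V)))⟩

section Ensemble

variable {V : Type*} [NormedAddCommGroup V] [InnerProductSpace ℂ V] [CompleteSpace V]
  [FiniteDimensional ℂ V] {K : ℕ}

/-- Families `(U_k)_k` of unitary operators on the spaces `𝓜_k` spanned by the eigenstates
with energy in the `k`-th window. -/
abbrev WindowUnitaries (A : V →L[ℂ] V) (M : Fin (K + 1) → Set ℝ) : Type _ :=
  (k : Fin (K + 1)) → UnitaryOp (spectralSubspace A (M k))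

/-- The `U_k` are drawn independently, each from the Haar measure on its window space. -/
def windowHaar (A : V →L[ℂ] V) (M : Fin (K + 1) → Set ℝ) : Measure (WindowUnitaries A M) :=
  Measure.pi fun k => haarUnitary (spectralSubspace A (M k))

/-- The direct sum `⨁_k U_k` as an operator on the whole space. -/
def directSumUnitary (A : V →L[ℂ] V) (M : Fin (K + 1) → Set ℝ) (U : WindowUnitaries A M) :
    V →L[ℂ] V :=
  ∑ k, (spectralSubspace A (M k)).subtypeL ∘L
    ((U k : spectralSubspace A (M k) →L[ℂ] spectralSubspace A (M k)) ∘L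
      (spectralSubspace A (M k)).orthogonalProjectionOnto)

/-- The ensemble average `𝔼_U ⟨ψ| U† A U |ψ⟩`. -/
def ensembleEnergy (A : V →L[ℂ] V) (M : Fin (K + 1) → Set ℝ) (ψ : V) : ℝ :=
  ∫ U, energy A (directSumUnitary A M U ψ) ∂(windowHaar A M)

end Ensemble

end

/-!
Let `e_j` be an eigenbasis of `H` with eigenvalues `lam j`, let `w j = |⟨e_j|ψ⟩|²` be the energy
distribution of `ψ`, and let `κ j` be the window containing `lam j`. Averaging over a Haar random
unitary makes the weights of a vector uniform in any orthonormal basis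
(`integral_normSq_inner_haarUnitary`; left invariance under transpositions of basis vectors is
enough), and since `H` preserves the windows there are no cross terms. Hence the ensemble energy is
the mean of `lam` after the weight of each window has been spread evenly over its eigenstates
(`ensembleEnergy_eq_fiberAverage`), and the theorem compares this mean with `∑ j, w j * lam j`.

Two facts control the comparison, with energies measured from the mean `η N`.

* The energy variance of a product state is `O(N)`, because terms of `H` with disjoint supports are
  uncorrelated (`inner_apply_apply_of_disjoint`, `normSq_sub_energy_smul_le`).
* The spectral decay makes the uniform mean over the top window `O(√N)`
  (`sum_abs_le_of_cubic_tail`), as `∑ 1 / m ^ 3` converges.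

The windows in the middle have width `δ N = O(√N)`, so spreading inside them costs `O(√N)` in
total. Energies in the bottom window can be as far as `O(N)` from the mean, but by Chebyshev's
inequality this window has weight at most `O(N / ((η - η') N)²) = O(1 / (√N log √N))`
(`weight_mul_extensive_le`); the variance bound alone suffices here. Finally
`abs_fiberAverage_le` adds the contributions up.
-/

/-! ### Haar averages of squared matrix elements -/

section Haar

variable {V : Type*} [NormedAddCommGroup V] [InnerProductSpace ℂ V] [CompleteSpace V]

theorem continuous_normSq_inner_unitary (x v : V) :
    Continuous fun U : UnitaryOp V => ‖inner ℂ x ((U : V →L[ℂ] V) v)‖ ^ 2 := by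
  have : Continuous fun U : UnitaryOp V => (U : V →L[ℂ] V) v :=
    (ContinuousLinearMap.apply ℂ V v).continuous.comp continuous_subtype_val
  fun_prop

theorem norm_unitaryOp_apply (U : UnitaryOp V) (v : V) : ‖(U : V →L[ℂ] V) v‖ = ‖v‖ :=
  (Unitary.linearIsometryEquiv U).norm_map v

variable [FiniteDimensional ℂ V]

theorem integrable_normSq_inner_haarUnitary (x v : V) :
    Integrable (fun U : UnitaryOp V => ‖inner ℂ x ((U : V →L[ℂ] V) v)‖ ^ 2) (haarUnitary V) :=
  (continuous_normSq_inner_unitary x v).integrable_of_hasCompactSupport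
    (HasCompactSupport.of_compactSpace _)

/-- A Haar random unitary sends a fixed vector to one with equidistributed weights in any
orthonormal basis: left invariance under the unitary exchanging two basis vectors makes the
expected weights equal, and they add up to `‖v‖ ^ 2`. -/
theorem integral_normSq_inner_haarUnitary {ι : Type*} [Fintype ι] (b : OrthonormalBasis ι ℂ V)
    (i : ι) (v : V) :
    ∫ U : UnitaryOp V, ‖inner ℂ (b i) ((U : V →L[ℂ] V) v)‖ ^ 2 ∂(haarUnitary V) =
      ‖v‖ ^ 2 / Fintype.card ι := by
  classical
  have hswap : ∀ j, ∫ U : UnitaryOp V, ‖inner ℂ (b j) ((U : V →L[ℂ] V) v)‖ ^ 2 ∂(haarUnitary V) =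
      ∫ U : UnitaryOp V, ‖inner ℂ (b i) ((U : V →L[ℂ] V) v)‖ ^ 2 ∂(haarUnitary V) := by
    intro j
    have : (haarUnitary V).IsMulLeftInvariant := by unfold haarUnitary; infer_instance
    let W : V ≃ₗᵢ[ℂ] V := b.equiv b (Equiv.swap i j)
    have hW : ∀ x, inner ℂ (b j) (W x) = inner ℂ (b i) x := fun x => by
      have : W (b i) = b j := by simp [W]
      rw [← this, W.inner_map_map]
    rw [← integral_mul_left_eq_self _ (Unitary.linearIsometryEquiv.symm W)]
    refine integral_congr_ae (Filter.Eventually.of_forall fun U => ?_)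
    simp only [Submonoid.coe_mul, mul_apply_eq_comp]
    rw [show ∀ x, ((Unitary.linearIsometryEquiv.symm W : UnitaryOp V) : V →L[ℂ] V) x = W x from
      fun x => rfl, hW]
  have hsum : ∑ j, ∫ U : UnitaryOp V, ‖inner ℂ (b j) ((U : V →L[ℂ] V) v)‖ ^ 2 ∂(haarUnitary V) =
      ‖v‖ ^ 2 := by
    rw [← integral_finsetSum _ fun j _ => integrable_normSq_inner_haarUnitary (b j) v]
    simp [b.sum_sq_norm_inner_right, norm_unitaryOp_apply]
  rw [Finset.sum_congr rfl fun j _ => hswap j, Finset.sum_const, nsmul_eq_mul,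
    Finset.card_univ] at hsum
  have : Nonempty ι := ⟨i⟩
  rw [eq_div_iff (by exact_mod_cast Fintype.card_ne_zero), mul_comm, hsum]

end Haar

/-! ### Spreading weights over the fibres of a map -/

theorem sum_inv_cube_le_two (M : ℕ) : ∑ m ∈ Finset.Icc 1 M, 1 / (m : ℝ) ^ 3 ≤ 2 := by
  -- telescoping, from `1 / m ^ 3 ≤ 1 / (m ^ 2 - 1 / 4) = 1 / (m - 1 / 2) - 1 / (m + 1 / 2)`
  suffices h : ∑ m ∈ Finset.Icc 1 M, 1 / (m : ℝ) ^ 3 ≤ 2 - 1 / ((M : ℝ) + 1 / 2) by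
    have : 0 < 1 / ((M : ℝ) + 1 / 2) := by positivity
    linarith
  induction M with
  | zero => norm_num
  | succ k ih =>
    rw [Finset.sum_Icc_succ_top (by omega)]
    have hk : (0 : ℝ) ≤ k := k.cast_nonneg
    have key : 1 / ((k : ℝ) + 1) ^ 3 ≤ 1 / ((k : ℝ) + 1 / 2) - 1 / ((k : ℝ) + 1 + 1 / 2) := by
      rw [div_sub_div _ _ (by positivity) (by positivity),
        div_le_div_iff₀ (by positivity) (by positivity)]
      nlinarith [mul_nonneg hk hk, mul_nonneg (mul_nonneg hk hk) hk]
    push_cast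
    linarith

/-- A cubic tail bound on the number of `j` with `y j ≥ t` makes the sum of the positive parts
at most of the order of the number of terms: `y₊ ≤ 1 + #{m ≥ 1 | m ≤ y}`. -/
theorem sum_max_zero_le_of_cubic_tail {ι : Type*} [Fintype ι] (y : ι → ℝ) (F : Finset ι) (c : ℝ)
    (hc : 0 ≤ c)
    (h : ∀ t : ℝ, 0 < t → ((Finset.univ.filter fun j => t ≤ y j).card : ℝ) ≤ 1 / t ^ 3 * c) :
    ∑ j ∈ F, max (y j) 0 ≤ F.card + 2 * c := by
  classical
  obtain ⟨M, hM⟩ : ∃ M : ℕ, ∀ j, ⌊y j⌋₊ ≤ M :=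
    ⟨∑ j, ⌊y j⌋₊, fun j => Finset.single_le_sum (f := fun j => ⌊y j⌋₊)
      (fun _ _ => Nat.zero_le _) (Finset.mem_univ j)⟩
  have hpt : ∀ j, max (y j) 0 ≤ 1 + ∑ m ∈ Finset.Icc 1 M, if (m : ℝ) ≤ y j then (1 : ℝ) else 0 := by
    intro j
    have h1 : (⌊y j⌋₊ : ℝ) ≤ ∑ m ∈ Finset.Icc 1 M, if (m : ℝ) ≤ y j then (1 : ℝ) else 0 := by
      rw [← Finset.sum_filter, Finset.sum_const, nsmul_eq_mul, mul_one]
      have : (Finset.Icc 1 ⌊y j⌋₊).card ≤ ((Finset.Icc 1 M).filter fun m : ℕ => (m : ℝ) ≤ y j).card := by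
        apply Finset.card_le_card
        intro m hm
        rw [Finset.mem_Icc] at hm
        rw [Finset.mem_filter, Finset.mem_Icc]
        exact ⟨⟨hm.1, hm.2.trans (hM j)⟩, (Nat.le_floor_iff' (by omega)).mp hm.2⟩
      rw [Nat.card_Icc, Nat.add_sub_cancel] at this
      exact_mod_cast this
    have h2 := Nat.lt_floor_add_one (y j)
    have h3 : (0 : ℝ) ≤ (⌊y j⌋₊ : ℝ) := Nat.cast_nonneg _
    exact max_le (by linarith) (by linarith)
  calc ∑ j ∈ F, max (y j) 0
      ≤ ∑ j ∈ F, (1 + ∑ m ∈ Finset.Icc 1 M, if (m : ℝ) ≤ y j then (1 : ℝ) else 0) :=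
        Finset.sum_le_sum fun j _ => hpt j
    _ = F.card + ∑ m ∈ Finset.Icc 1 M, ∑ j ∈ F, if (m : ℝ) ≤ y j then (1 : ℝ) else 0 := by
        rw [Finset.sum_add_distrib, Finset.sum_comm (s := F)]; simp
    _ ≤ F.card + ∑ m ∈ Finset.Icc 1 M, 1 / (m : ℝ) ^ 3 * c := by
        gcongr with m hm
        have hm1 : 0 < (m : ℝ) := by
          have := (Finset.mem_Icc.mp hm).1
          exact_mod_cast this
        refine le_trans ?_ (h m hm1)
        rw [← Finset.sum_filter, Finset.sum_const, nsmul_eq_mul, mul_one]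
        exact_mod_cast Finset.card_le_card (Finset.filter_subset_filter _ (Finset.subset_univ F))
    _ ≤ F.card + 2 * c := by
        rw [← Finset.sum_mul]
        gcongr
        exact sum_inv_cube_le_two M

/-- The expectation of `f` after the weights `w` have been spread evenly over each fibre of
`κ`. The cardinality in the denominator is positive, since `j` lies in its own fibre. -/
noncomputable def fiberAverage {ι κι : Type*} [Fintype ι] [DecidableEq κι] (κ : ι → κι)
    (w f : ι → ℝ) : ℝ :=
  ∑ j, f j * ((∑ i with κ i = κ j, w i) / (Finset.univ.filter fun i => κ i = κ j).card)

theorem fiberAverage_eq_sum {ι κι : Type*} [Fintype ι] [Fintype κι] [DecidableEq κι]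
    (κ : ι → κι) (w f : ι → ℝ) :
    fiberAverage κ w f = ∑ k, (∑ j with κ j = k, (∑ i with κ i = k, w i) * f j) /
      (Finset.univ.filter fun i => κ i = k).card := by
  rw [fiberAverage, ← Finset.sum_fiberwise Finset.univ κ]
  refine Finset.sum_congr rfl fun k _ => ?_
  rw [Finset.sum_div]
  refine Finset.sum_congr rfl fun j hj => ?_
  rw [(Finset.mem_filter.mp hj).2]
  ring

theorem fiberAverage_const {ι κι : Type*} [Fintype ι] [Fintype κι] [DecidableEq κι]
    (κ : ι → κι) (w : ι → ℝ) (c : ℝ) : fiberAverage κ w (fun _ => c) = (∑ j, w j) * c := by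
  rw [fiberAverage_eq_sum, ← Finset.sum_fiberwise Finset.univ κ, Finset.sum_mul]
  refine Finset.sum_congr rfl fun k _ => ?_
  rw [Finset.sum_const, nsmul_eq_mul]
  rcases Finset.eq_empty_or_nonempty (Finset.univ.filter fun i => κ i = k) with h | h
  · simp [h]
  · have : ((Finset.univ.filter fun i => κ i = k).card : ℝ) ≠ 0 := by
      exact_mod_cast h.card_pos.ne'
    field_simp

theorem fiberAverage_add {ι κι : Type*} [Fintype ι] [DecidableEq κι]
    (κ : ι → κι) (w f f' : ι → ℝ) :
    fiberAverage κ w (fun j => f j + f' j) = fiberAverage κ w f + fiberAverage κ w f' := by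
  simp only [fiberAverage, add_mul, Finset.sum_add_distrib]

/-- Spreading the weights over the fibres of `κ` moves a mean by at most the sum of: the uniform
mean of `x` on the fibre of `k₀`, the contribution of the fibre of `k₁`, the oscillation `Δ` on the
other fibres, and the first absolute moment of the original weights. -/
theorem abs_fiberAverage_le {ι κι : Type*} [Fintype ι] [Fintype κι] [DecidableEq κι]
    (κ : ι → κι) (w x : ι → ℝ) (k₀ k₁ : κι) (B₀ B₁ Δ : ℝ)
    (hB₀ : 0 ≤ B₀) (hB₁ : 0 ≤ B₁) (hΔ : 0 ≤ Δ)
    (hw : ∀ j, 0 ≤ w j) (hw1 : ∑ j, w j = 1)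
    (h₀ : |∑ j with κ j = k₀, x j| ≤ B₀ * (Finset.univ.filter fun i => κ i = k₀).card)
    (h₁ : ∀ j, κ j = k₁ → (∑ i with κ i = k₁, w i) * |x j| ≤ B₁)
    (hmid : ∀ i j, κ i = κ j → κ i ≠ k₀ → κ i ≠ k₁ → |x j| ≤ |x i| + Δ) :
    |fiberAverage κ w x| ≤ B₀ + B₁ + ∑ j, w j * |x j| + Δ := by
  set p : κι → ℝ := fun k => ∑ i with κ i = k, w i with hp
  have hp0 : ∀ k, 0 ≤ p k := fun k => Finset.sum_nonneg fun i _ => hw i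
  have hpsum : ∑ k, p k = 1 := by rw [hp, Finset.sum_fiberwise, hw1]
  have hp1 : ∀ k, p k ≤ 1 := fun k =>
    hpsum ▸ Finset.single_le_sum (fun i _ => hp0 i) (Finset.mem_univ k)
  have hq0 : ∀ k, 0 ≤ ∑ j with κ j = k, w j * |x j| := fun k =>
    Finset.sum_nonneg fun i _ => mul_nonneg (hw i) (abs_nonneg _)
  have key : ∀ k, |(∑ j with κ j = k, p k * x j) / (Finset.univ.filter fun i => κ i = k).card| ≤
      (if k = k₀ then B₀ else 0) + (if k = k₁ then B₁ else 0) +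
        ∑ j with κ j = k, w j * |x j| + p k * Δ := by
    intro k
    have hpΔ := mul_nonneg (hp0 k) hΔ
    have hi0 : 0 ≤ if k = k₀ then B₀ else 0 := by split_ifs <;> simp [hB₀]
    have hi1 : 0 ≤ if k = k₁ then B₁ else 0 := by split_ifs <;> simp [hB₁]
    rw [abs_div, Nat.abs_cast]
    refine div_le_of_le_mul₀ (Nat.cast_nonneg _) (by linarith [hq0 k]) ?_
    by_cases hk0 : k = k₀
    · rw [← Finset.mul_sum, abs_mul, abs_of_nonneg (hp0 k)]
      calc p k * |∑ j with κ j = k, x j|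
          ≤ 1 * (B₀ * (Finset.univ.filter fun i => κ i = k).card) := by
            subst hk0
            exact mul_le_mul (hp1 k) h₀ (abs_nonneg _) zero_le_one
        _ ≤ _ := by
            rw [one_mul]
            gcongr
            rw [if_pos hk0]
            linarith [hq0 k]
    · rw [mul_comm _ ((Finset.card _ : ℕ) : ℝ), ← nsmul_eq_mul]
      refine (Finset.abs_sum_le_sum_abs _ _).trans (Finset.sum_le_card_nsmul _ _ _ ?_)
      intro j hj
      have hj' := (Finset.mem_filter.mp hj).2
      rw [abs_mul, abs_of_nonneg (hp0 k)]
      by_cases hk1 : k = k₁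
      · have := h₁ j (hj'.trans hk1)
        rw [← hk1] at this
        rw [if_pos hk1]
        change p k * |x j| ≤ B₁ at this
        linarith [hq0 k]
      · rw [if_neg hk0, if_neg hk1]
        calc p k * |x j| = ∑ i with κ i = k, w i * |x j| := by rw [hp, Finset.sum_mul]
          _ ≤ ∑ i with κ i = k, w i * (|x i| + Δ) := by
              refine Finset.sum_le_sum fun i hi => mul_le_mul_of_nonneg_left ?_ (hw i)
              have hi' := (Finset.mem_filter.mp hi).2
              exact hmid i j (hi'.trans hj'.symm) (hi' ▸ hk0) (hi' ▸ hk1)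
          _ = _ := by
              simp only [mul_add, Finset.sum_add_distrib, hp, Finset.sum_mul]; ring
  rw [fiberAverage_eq_sum]
  refine (Finset.abs_sum_le_sum_abs _ _).trans ((Finset.sum_le_sum fun k _ => key k).trans ?_)
  simp only [Finset.sum_add_distrib, ← Finset.sum_mul, hpsum, Finset.sum_ite_eq',
    Finset.mem_univ, if_true, one_mul, Finset.sum_fiberwise]
  exact le_rfl

/-! ### Spectral subspaces and the ensemble energy in an eigenbasis -/

section Spectral

variable {V : Type*} [NormedAddCommGroup V] [InnerProductSpace ℂ V] {ι : Type*} [Fintype ι]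
  {A : V →L[ℂ] V} (e : OrthonormalBasis ι ℂ V) {lam : ι → ℝ}

theorem mem_spectralSubspace_of_eigen {S : Set ℝ} {E : ℝ} {v : V} (hE : E ∈ S)
    (hv : A v = (E : ℂ) • v) : v ∈ spectralSubspace A S :=
  Submodule.subset_span ⟨E, hE, hv⟩

theorem inner_apply_of_eigenbasis (he : ∀ j, A (e j) = (lam j : ℂ) • e j) (j : ι) (v : V) :
    inner ℂ (e j) (A v) = (lam j : ℂ) * inner ℂ (e j) v := by
  classical
  conv_lhs => rw [← e.sum_repr' v]
  simp [map_sum, he, orthonormal_iff_ite.mp e.orthonormal, mul_comm]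

theorem energy_eq_sum_of_eigenbasis (he : ∀ j, A (e j) = (lam j : ℂ) • e j) (v : V) :
    energy A v = ∑ j, lam j * ‖inner ℂ (e j) v‖ ^ 2 := by
  rw [energy, ← e.sum_inner_mul_inner, Complex.re_sum]
  refine Finset.sum_congr rfl fun j _ => ?_
  rw [inner_apply_of_eigenbasis e he, mul_left_comm, ← inner_conj_symm v, RCLike.conj_mul,
    Complex.re_ofReal_mul]
  norm_cast

theorem normSq_sub_smul_eq_sum_of_eigenbasis (he : ∀ j, A (e j) = (lam j : ℂ) • e j) (v : V)
    (c : ℝ) : ‖A v - (c : ℂ) • v‖ ^ 2 = ∑ j, ‖inner ℂ (e j) v‖ ^ 2 * (lam j - c) ^ 2 := by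
  rw [← e.sum_sq_norm_inner_right]
  refine Finset.sum_congr rfl fun j _ => ?_
  rw [inner_sub_right, inner_apply_of_eigenbasis e he, inner_smul_right, ← sub_mul, norm_mul,
    ← Complex.ofReal_sub, Complex.norm_real, mul_pow, Real.norm_eq_abs, sq_abs, mul_comm]

theorem abs_eigenvalue_le_norm (he : ∀ j, A (e j) = (lam j : ℂ) • e j) (j : ι) :
    |lam j| ≤ ‖A‖ := by
  have := A.le_opNorm (e j)
  rwa [he, norm_smul, e.orthonormal.1, mul_one, mul_one, Complex.norm_real] at this

theorem inner_eq_zero_of_mem_spectralSubspace (he : ∀ j, A (e j) = (lam j : ℂ) • e j) {S : Set ℝ}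
    {j : ι} (hj : lam j ∉ S) {x : V} (hx : x ∈ spectralSubspace A S) : inner ℂ (e j) x = 0 := by
  induction hx using Submodule.span_induction with
  | mem x hx =>
    obtain ⟨E, hE, hx⟩ := hx
    have h := inner_apply_of_eigenbasis e he j x
    rw [hx, inner_smul_right, ← sub_eq_zero, ← sub_mul, mul_eq_zero, sub_eq_zero] at h
    refine h.resolve_left fun h => hj ?_
    rwa [← Complex.ofReal_inj.mp h]
  | zero => simp
  | add x y _ _ hx hy => rw [inner_add_right, hx, hy, add_zero]
  | smul c x _ hx => rw [inner_smul_right, hx, mul_zero]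

theorem orthonormal_spectralSubspace (he : ∀ j, A (e j) = (lam j : ℂ) • e j) (S : Set ℝ) :
    Orthonormal ℂ fun j : {j // lam j ∈ S} =>
      (⟨e j, mem_spectralSubspace_of_eigen j.2 (he j)⟩ : spectralSubspace A S) := by
  have := e.orthonormal.comp (Subtype.val : {j // lam j ∈ S} → ι) Subtype.val_injective
  exact ⟨fun j => this.1 j, fun i j hij => this.2 hij⟩

/-- The eigenvectors of an eigenbasis with eigenvalue in `S`, as an orthonormal basis of the
spectral subspace of `S`. -/
noncomputable def spectralBasis (he : ∀ j, A (e j) = (lam j : ℂ) • e j) (S : Set ℝ)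
    [Fintype {j // lam j ∈ S}] :
    OrthonormalBasis {j // lam j ∈ S} ℂ (spectralSubspace A S) :=
  OrthonormalBasis.mkOfOrthogonalEqBot
    (orthonormal_spectralSubspace e he S)
    (by
      rw [Submodule.eq_bot_iff]
      intro x hx
      rw [Submodule.mem_orthogonal] at hx
      have hx0 : ∀ j, inner ℂ (e j) (x : V) = 0 := by
        intro j
        by_cases hj : lam j ∈ S
        · exact hx _ (Submodule.subset_span ⟨⟨j, hj⟩, rfl⟩)
        · exact inner_eq_zero_of_mem_spectralSubspace e he hj x.2
      have := e.sum_repr' (x : V)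
      simp only [hx0, zero_smul, Finset.sum_const_zero] at this
      exact Subtype.ext this.symm)

theorem coe_spectralBasis (he : ∀ j, A (e j) = (lam j : ℂ) • e j) (S : Set ℝ)
    [Fintype {j // lam j ∈ S}] (j : {j // lam j ∈ S}) : (spectralBasis e he S j : V) = e j := by
  rw [spectralBasis, OrthonormalBasis.coe_of_orthogonal_eq_bot_mk]

theorem finrank_spectralSubspace (he : ∀ j, A (e j) = (lam j : ℂ) • e j) (S : Set ℝ)
    [DecidablePred fun j => lam j ∈ S] :
    Module.finrank ℂ (spectralSubspace A S) = (Finset.univ.filter fun j => lam j ∈ S).card := by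
  rw [Module.finrank_eq_card_basis (spectralBasis e he S).toBasis, Fintype.card_subtype]

variable [FiniteDimensional ℂ V]

theorem normSq_orthogonalProjection_spectralSubspace (he : ∀ j, A (e j) = (lam j : ℂ) • e j)
    (S : Set ℝ) [DecidablePred fun j => lam j ∈ S] (v : V) :
    ‖(spectralSubspace A S).orthogonalProjectionOnto v‖ ^ 2 =
      ∑ j with lam j ∈ S, ‖inner ℂ (e j) v‖ ^ 2 := by
  rw [← (spectralBasis e he S).sum_sq_norm_inner_right]
  have : ∀ j, inner ℂ (spectralBasis e he S j) ((spectralSubspace A S).orthogonalProjectionOnto v) =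
      inner ℂ (e j) v := fun j => by
    rw [Submodule.inner_orthogonalProjectionOnto_eq_of_mem_left, coe_spectralBasis]
  simp only [this]
  exact (Finset.sum_subtype (Finset.univ.filter fun j => lam j ∈ S) (fun j => by simp)
    fun j => ‖inner ℂ (e j) v‖ ^ 2).symm

variable {K : ℕ} {M : Fin (K + 1) → Set ℝ} {κ : ι → Fin (K + 1)}

theorem inner_directSumUnitary (he : ∀ j, A (e j) = (lam j : ℂ) • e j)
    (hκ : ∀ j k, lam j ∈ M k ↔ κ j = k) (U : WindowUnitaries A M) (v : V) (j : ι) :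
    inner ℂ (e j) (directSumUnitary A M U v) =
      inner ℂ (e j) (((U (κ j) : spectralSubspace A (M (κ j)) →L[ℂ] spectralSubspace A (M (κ j)))
        ((spectralSubspace A (M (κ j))).orthogonalProjectionOnto v) :
          spectralSubspace A (M (κ j))) : V) := by
  rw [directSumUnitary, sum_apply, inner_sum, Finset.sum_eq_single (κ j)]
  · rfl
  · intro k _ hk
    exact inner_eq_zero_of_mem_spectralSubspace e he (fun h => hk ((hκ j k).mp h).symm)
      (Subtype.property _)
  · simp

/-- In an eigenbasis, the ensemble average spreads the weights `|⟨e_j|v⟩|²` evenly over each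
energy window. -/
theorem ensembleEnergy_eq_fiberAverage (he : ∀ j, A (e j) = (lam j : ℂ) • e j)
    (hκ : ∀ j k, lam j ∈ M k ↔ κ j = k) (v : V) :
    ensembleEnergy A M v = fiberAverage κ (fun j => ‖inner ℂ (e j) v‖ ^ 2) lam := by
  classical
  -- each summand depends on one of the independent factors only
  let f : ∀ j, UnitaryOp (spectralSubspace A (M (κ j))) → ℝ := fun j u =>
    ‖inner ℂ (spectralBasis e he (M (κ j)) ⟨j, (hκ j _).mpr rfl⟩)
      ((u : spectralSubspace A (M (κ j)) →L[ℂ] spectralSubspace A (M (κ j)))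
        ((spectralSubspace A (M (κ j))).orthogonalProjectionOnto v))‖ ^ 2
  have hf : ∀ j (U : WindowUnitaries A M),
      ‖inner ℂ (e j) (directSumUnitary A M U v)‖ ^ 2 = f j (U (κ j)) := by
    intro j U
    rw [inner_directSumUnitary e he hκ]
    simp only [f, Submodule.coe_inner, coe_spectralBasis]
  have hfi : ∀ j, Integrable (f j) (haarUnitary (spectralSubspace A (M (κ j)))) := fun j =>
    integrable_normSq_inner_haarUnitary _ _
  have hmp : ∀ j, MeasurePreserving (fun U : WindowUnitaries A M => U (κ j)) (windowHaar A M)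
      (haarUnitary (spectralSubspace A (M (κ j)))) := fun j =>
    measurePreserving_eval (fun k => haarUnitary (spectralSubspace A (M k))) (κ j)
  have hint : ∀ j, ∫ U : WindowUnitaries A M, f j (U (κ j)) ∂(windowHaar A M) =
      (∑ i with κ i = κ j, ‖inner ℂ (e i) v‖ ^ 2) /
        (Finset.univ.filter fun i => κ i = κ j).card := by
    intro j
    rw [← integral_map (hmp j).measurable.aemeasurable (by
      rw [(hmp j).map_eq]; exact (hfi j).aestronglyMeasurable), (hmp j).map_eq]
    simp only [f]
    rw [integral_normSq_inner_haarUnitary, normSq_orthogonalProjection_spectralSubspace e he,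
      Fintype.card_subtype]
    simp only [hκ]
  rw [ensembleEnergy, fiberAverage]
  simp only [energy_eq_sum_of_eigenbasis e he, hf]
  have hfi' : ∀ j, Integrable (fun U : WindowUnitaries A M => f j (U (κ j))) (windowHaar A M) :=
    fun j => (hmp j).integrable_comp_of_integrable (hfi j)
  rw [integral_finsetSum _ fun j _ => (hfi' j).const_mul _]
  exact Finset.sum_congr rfl fun j _ => by rw [integral_const_mul, hint]

end Spectral

/-! ### Energy fluctuations of product states -/

section ProductState

variable {D n d : ℕ}

open Classical in
/-- An operator acting on `X` only mixes the values of a configuration on `X`. -/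
theorem actsOn_apply {X : Set (Site D n)} {A : LatticeOp D n d}
    {B : Matrix (X → Fin d) (X → Fin d) ℂ}
    (hB : ∀ s t : Site D n → Fin d,
      ((∀ i, i ∉ X → s i = t i) → matrixElement A s t = B (fun i => s i) (fun i => t i)) ∧
      ((∃ i, i ∉ X ∧ s i ≠ t i) → matrixElement A s t = 0))
    (v : LatticeSpace D n d) (s : Site D n → Fin d) :
    A v s = ∑ y : X → Fin d,
      B (fun i => s i) y * v (fun i => if h : i ∈ X then y ⟨i, h⟩ else s i) := by
  have h1 : A v s = ∑ t, matrixElement A s t * v t := by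
    have hv : v = ∑ t, v t • EuclideanSpace.single t (1 : ℂ) := by
      ext u
      simp [Finset.sum_apply, Pi.single_apply]
    conv_lhs => rw [hv]
    simp [map_sum, Finset.sum_apply, matrixElement, mul_comm]
  rw [h1]
  symm
  refine Finset.sum_of_injOn (fun y i => if h : i ∈ X then y ⟨i, h⟩ else s i) ?_ (by simp) ?_ ?_
  · intro y _ y' _ hyy
    funext i
    have := congrFun hyy i.1
    simpa using this
  · intro t _ ht
    rw [(hB s t).2, zero_mul]
    by_contra! hcon
    refine ht ⟨fun i => t i, by simp, ?_⟩
    funext i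
    by_cases hi : i ∈ X
    · simp [hi]
    · simp [hi, hcon i hi]
  · intro y _
    rw [(hB s _).1 (fun i hi => by simp [hi])]
    congr 2
    funext i
    simp

/-- For a product state `ψ` and `A` acting on `X`, the vector `Aψ ⊗ ψ` is unchanged when some
sites outside `X` are exchanged between the two copies. -/
theorem actsOn_apply_mul_symm {X : Set (Site D n)} {A : LatticeOp D n d} (hA : ActsOn X A)
    {ψ : LatticeSpace D n d} (hψ : IsProductState ψ) {s t s' t' : Site D n → Fin d}
    (hX : ∀ i ∈ X, s' i = s i ∧ t' i = t i)
    (hXc : ∀ i, (s' i = s i ∧ t' i = t i) ∨ (s' i = t i ∧ t' i = s i)) :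
    A ψ s * ψ t = A ψ s' * ψ t' := by
  classical
  obtain ⟨B, hB⟩ := hA
  obtain ⟨φ, -, hφ⟩ := hψ
  rw [actsOn_apply hB, actsOn_apply hB, Finset.sum_mul, Finset.sum_mul]
  refine Finset.sum_congr rfl fun y _ => ?_
  rw [show (fun i : X => s' i) = fun i : X => s i from funext fun i => (hX i i.2).1]
  rw [mul_assoc, mul_assoc]
  congr 1
  rw [hφ, hφ, hφ, hφ, ← Finset.prod_mul_distrib, ← Finset.prod_mul_distrib]
  refine Finset.prod_congr rfl fun i _ => ?_
  by_cases hi : i ∈ X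
  · simp [hi, (hX i hi).2]
  · rcases hXc i with ⟨h1, h2⟩ | ⟨h1, h2⟩
    · simp [hi, h1, h2]
    · simp [hi, h1, h2, mul_comm]

theorem IsProductState.norm_eq_one {ψ : LatticeSpace D n d} (hψ : IsProductState ψ) : ‖ψ‖ = 1 := by
  classical
  obtain ⟨φ, h1, hφ⟩ := hψ
  have : ‖ψ‖ ^ 2 = 1 := by
    rw [EuclideanSpace.norm_sq_eq]
    calc ∑ s, ‖ψ s‖ ^ 2 = ∑ s : Site D n → Fin d, ∏ i, ‖φ i (s i)‖ ^ 2 := by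
          refine Finset.sum_congr rfl fun s _ => ?_
          rw [hφ, norm_prod, Finset.prod_pow]
      _ = ∏ i, ∑ a, ‖φ i a‖ ^ 2 := (Fintype.prod_sum fun i a => ‖φ i a‖ ^ 2).symm
      _ = 1 := by
          refine Finset.prod_eq_one fun i _ => ?_
          rw [← EuclideanSpace.norm_sq_eq, h1, one_pow]
  nlinarith [norm_nonneg ψ]

open Classical in
/-- The exchange of the coordinates outside `X` between two configurations. -/
noncomputable def exchangeOutside (X : Set (Site D n)) :
    Equiv.Perm ((Site D n → Fin d) × (Site D n → Fin d)) :=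
  Function.Involutive.toPerm
    (fun q => (fun i => if i ∈ X then q.1 i else q.2 i, fun i => if i ∈ X then q.2 i else q.1 i))
    (fun q => by
      ext i <;> by_cases hi : i ∈ X <;> simp [hi])

/-- Operators acting on disjoint regions are uncorrelated in a product state. The identity is
obtained on `ψ ⊗ ψ`, by exchanging the two copies outside the first region. -/
theorem inner_apply_apply_of_disjoint {X Y : Set (Site D n)} (hXY : Disjoint X Y)
    {A B : LatticeOp D n d} (hA : ActsOn X A) (hB : ActsOn Y B)
    {ψ : LatticeSpace D n d} (hψ : IsProductState ψ) :
    inner ℂ (A ψ) (B ψ) = inner ℂ (A ψ) ψ * inner ℂ ψ (B ψ) := by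
  classical
  have h1 : inner ℂ (A ψ) (B ψ) = inner ℂ (A ψ) (B ψ) * inner ℂ ψ ψ := by
    rw [inner_self_eq_norm_sq_to_K, hψ.norm_eq_one]; simp
  rw [h1]
  simp only [PiLp.inner_apply, RCLike.inner_apply, Finset.sum_mul_sum]
  rw [← Fintype.sum_prod_type', ← Fintype.sum_prod_type']
  refine Fintype.sum_equiv (exchangeOutside X) _ _ fun q => ?_
  obtain ⟨s, t⟩ := q
  set s' : Site D n → Fin d := fun i => if i ∈ X then s i else t i with hs'
  set t' : Site D n → Fin d := fun i => if i ∈ X then t i else s i with ht'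
  have hq : exchangeOutside X (s, t) = (s', t') := rfl
  rw [hq]
  have eA : A ψ s * ψ t = A ψ s' * ψ t' := actsOn_apply_mul_symm hA hψ
    (fun i hi => by simp [hs', ht', hi]) (fun i => by by_cases hi : i ∈ X <;> simp [hs', ht', hi])
  have eB : B ψ s * ψ t = B ψ t' * ψ s' := actsOn_apply_mul_symm hB hψ
    (fun i hi => by simp [hs', ht', hXY.notMem_of_mem_right hi])
    (fun i => by by_cases hi : i ∈ X <;> simp [hs', ht', hi])
  have eA' := congrArg (starRingEnd ℂ) eA
  simp only [map_mul] at eA'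
  simp only
  linear_combination (starRingEnd ℂ (A ψ s) * starRingEnd ℂ (ψ t)) * eB +
    (B ψ t' * ψ s') * eA'

theorem card_not_disjoint_siteBall_le (r : ℕ) (i : Site D n) [DecidablePred fun j : Site D n =>
      ¬ Disjoint (siteBall r i) (siteBall r j)] :
    (Finset.univ.filter fun j : Site D n => ¬ Disjoint (siteBall r i) (siteBall r j)).card ≤
      (4 * r + 1) ^ D := by
  classical
  let F : Fin D → Finset (Fin n) := fun a =>
    Finset.univ.filter fun x => |((i a : ℕ) : ℤ) - ((x : ℕ) : ℤ)| ≤ 2 * r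
  have hF : ∀ a, (F a).card ≤ 4 * r + 1 := by
    intro a
    have : (F a).card ≤ (Finset.Icc (((i a : ℕ) : ℤ) - 2 * r) ((i a : ℕ) + 2 * r)).card := by
      refine Finset.card_le_card_of_injOn (fun x => ((x : ℕ) : ℤ)) ?_ ?_
      · intro x hx
        have := abs_le.mp (Finset.mem_filter.mp hx).2
        simp only [Finset.coe_Icc, Set.mem_Icc]
        omega
      · intro x _ y _ hxy
        exact Fin.ext (Int.ofNat_inj.mp hxy)
    rw [Int.card_Icc] at this
    omega
  have hsub : (Finset.univ.filter fun j : Site D n => ¬ Disjoint (siteBall r i) (siteBall r j)) ⊆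
      Fintype.piFinset F := by
    intro j hj
    obtain ⟨x, hx, hy⟩ := Set.not_disjoint_iff.mp (Finset.mem_filter.mp hj).2
    rw [Fintype.mem_piFinset]
    intro a
    have h1 := abs_le.mp (hx a)
    have h2 := abs_le.mp (hy a)
    simp only [F, Finset.mem_filter, Finset.mem_univ, true_and, abs_le]
    omega
  refine (Finset.card_le_card hsub).trans ?_
  rw [Fintype.card_piFinset]
  refine (Finset.prod_le_pow_card _ _ _ fun a _ => hF a).trans ?_
  simp

theorem card_site : Fintype.card (Site D n) = n ^ D := by simp

theorem inner_apply_eq_energy {V : Type*} [NormedAddCommGroup V] [InnerProductSpace ℂ V]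
    [CompleteSpace V] {A : V →L[ℂ] V} (hA : IsSelfAdjoint A) (v : V) :
    inner ℂ v (A v) = (energy A v : ℂ) := by
  exact (hA.isSymmetric.coe_re_inner_self_apply v).symm

theorem abs_energy_le {V : Type*} [NormedAddCommGroup V] [InnerProductSpace ℂ V]
    (A : V →L[ℂ] V) {v : V} (hv : ‖v‖ = 1) : |energy A v| ≤ ‖A‖ := by
  calc |energy A v| ≤ ‖inner ℂ v (A v)‖ := Complex.abs_re_le_norm _
    _ ≤ ‖v‖ * ‖A v‖ := norm_inner_le_norm _ _
    _ ≤ ‖v‖ * (‖A‖ * ‖v‖) := by gcongr; exact A.le_opNorm v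
    _ = ‖A‖ := by rw [hv]; ring

/-- The energy variance of a product state under a local Hamiltonian is extensive: only pairs of
terms with overlapping supports are correlated. -/
theorem normSq_sub_energy_smul_le {r : ℕ} {J : ℝ} {h : Site D n → LatticeOp D n d}
    (hh : IsLocalHamiltonian r J h) {ψ : LatticeSpace D n d} (hψ : IsProductState ψ) :
    ‖(∑ i, h i) ψ - ((energy (∑ i, h i) ψ : ℝ) : ℂ) • ψ‖ ^ 2 ≤
      4 * J ^ 2 * (4 * r + 1) ^ D * (n : ℝ) ^ D := by
  classical
  have hn := hψ.norm_eq_one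
  set v : Site D n → LatticeSpace D n d := fun i => h i ψ - ((energy (h i) ψ : ℝ) : ℂ) • ψ with hv
  have hsum : (∑ i, h i) ψ - ((energy (∑ i, h i) ψ : ℝ) : ℂ) • ψ = ∑ i, v i := by
    simp only [hv, Finset.sum_sub_distrib, ← Finset.sum_smul, sum_apply]
    congr 2
    rw [← Complex.ofReal_sum]
    simp [energy]
  have hvn : ∀ i, ‖v i‖ ≤ 2 * J := fun i => by
    have h1 : ‖h i ψ‖ ≤ J := by
      have := (h i).le_opNorm ψ
      rw [hn, mul_one] at this
      exact this.trans (hh.norm_le i)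
    have h2 := (abs_energy_le (h i) hn).trans (hh.norm_le i)
    calc ‖v i‖ ≤ ‖h i ψ‖ + ‖((energy (h i) ψ : ℝ) : ℂ) • ψ‖ := norm_sub_le _ _
      _ ≤ J + J := by
          rw [norm_smul, hn, mul_one, Complex.norm_real, Real.norm_eq_abs]
          exact add_le_add h1 h2
      _ = 2 * J := by ring
  have hzero : ∀ i j, Disjoint (siteBall r i) (siteBall r j) → inner ℂ (v i) (v j) = 0 := by
    intro i j hij
    have h1 := inner_apply_apply_of_disjoint hij (hh.actsOn i) (hh.actsOn j) hψ
    have ei := inner_apply_eq_energy (hh.selfAdjoint i) ψ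
    have ej := inner_apply_eq_energy (hh.selfAdjoint j) ψ
    have ei' : inner ℂ (h i ψ) ψ = (energy (h i) ψ : ℂ) := by
      rw [← inner_conj_symm, ei, Complex.conj_ofReal]
    have hψψ : inner ℂ ψ ψ = (1 : ℂ) := by rw [inner_self_eq_norm_sq_to_K, hn]; simp
    simp only [hv, inner_sub_left, inner_sub_right, inner_smul_left, inner_smul_right,
      Complex.conj_ofReal, h1, ej, ei', hψψ]
    ring
  rw [hsum, ← inner_self_eq_norm_sq (𝕜 := ℂ), sum_inner, map_sum]
  have hrow : ∀ i, RCLike.re (inner ℂ (v i) (∑ j, v j)) ≤ 4 * J ^ 2 * (4 * r + 1) ^ D := by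
    intro i
    rw [inner_sum, ← Finset.sum_filter_of_ne (p := fun j => ¬ Disjoint (siteBall r i) (siteBall r j))
      (fun j _ hj hd => hj (hzero i j hd)), map_sum]
    refine (Finset.sum_le_card_nsmul _ _ (4 * J ^ 2) fun j _ => ?_).trans ?_
    · refine (re_inner_le_norm _ _).trans ?_
      calc ‖v i‖ * ‖v j‖ ≤ (2 * J) * (2 * J) :=
            mul_le_mul (hvn i) (hvn j) (norm_nonneg _) ((norm_nonneg _).trans (hvn i))
        _ = 4 * J ^ 2 := by ring
    · rw [nsmul_eq_mul, mul_comm]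
      gcongr
      exact_mod_cast card_not_disjoint_siteBall_le r i
  refine (Finset.sum_le_card_nsmul _ _ _ fun i _ => hrow i).trans ?_
  rw [nsmul_eq_mul, Finset.card_univ, card_site, mul_comm]
  push_cast
  exact le_rfl

end ProductState

/-! ### Energy windows and the comparison of the two means -/

/-- For `0 < δ` and `1 ≤ K` the energy windows partition the energy axis. -/
theorem exists_energyWindow_index {N η η' δ : ℝ} {K : ℕ} (hN : 0 < N) (hδ : 0 < δ) (hK : 1 ≤ K)
    (hη' : η' = η - K * δ) (x : ℝ) :
    ∃ k : Fin (K + 1), ∀ k', x ∈ energyWindow N η η' δ K k' ↔ k = k' := by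
  have hδN : 0 < δ * N := mul_pos hδ hN
  -- the depth of `x` below `η N` in units of the window width
  set q : ℝ := (η * N - x) / (δ * N) with hq
  have hle : ∀ m : ℕ, ⌈q⌉₊ ≤ m ↔ (η - m * δ) * N ≤ x := fun m => by
    rw [Nat.ceil_le, hq, div_le_iff₀ hδN]
    constructor <;> intro h <;> linarith
  refine ⟨⟨min (⌈q⌉₊ - 1) K, by omega⟩, fun k' => ?_⟩
  obtain ⟨k', hk'⟩ := k'
  rw [Fin.mk.injEq]
  simp only [energyWindow]
  split_ifs with h0 h1
  · have := hle 1
    rw [Nat.cast_one, one_mul] at this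
    rw [Set.mem_Ici, ← this]
    omega
  · rw [Set.mem_Iio, hη', ← not_le, ← hle K]
    omega
  · have := hle (k' + 1)
    push_cast at this
    rw [Set.mem_Ico, ← this, ← not_le, ← hle k']
    omega

theorem sum_mul_sq_le_of_le_neg {ι : Type*} [Fintype ι] {w x : ι → ℝ} (hw : ∀ j, 0 ≤ w j)
    {T : ℝ} (hT : 0 ≤ T) (F : Finset ι) (hF : ∀ i ∈ F, T ≤ -x i) :
    (∑ i ∈ F, w i) * T ^ 2 ≤ ∑ j, w j * x j ^ 2 := by
  rw [Finset.sum_mul]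
  refine (Finset.sum_le_sum fun i hi => ?_).trans
    (Finset.sum_le_univ_sum_of_nonneg fun i => mul_nonneg (hw i) (sq_nonneg (x i)))
  rw [← neg_sq (x i)]
  have := hF i hi
  have := hw i
  gcongr

/-- A weight `p` at distance `u N` from the mean is, by Chebyshev's inequality and the lower bound
on `u`, of order `1 / √N`, so that it contributes at most `O(√N)` to an extensive quantity. -/
theorem weight_mul_extensive_le {N : ℕ} (hN : 1 ≤ N) {p u v g J : ℝ} (hp0 : 0 ≤ p) (hp1 : p ≤ 1)
    (hv : 0 ≤ v) (hg : 0 < g) (hJ : 0 ≤ J) (hcheb : p * (u * N) ^ 2 ≤ v * N)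
    (hgap : g * (Real.log √(N : ℝ) / √(N : ℝ)) ≤ u ^ 2) :
    p * (2 * J * N) ≤ (2 * J + 2 * J * v / (g * Real.log √2)) * √(N : ℝ) := by
  have hl0 : 0 < Real.log √2 := Real.log_pos (Real.lt_sqrt_of_sq_lt (by norm_num))
  set l := Real.log √2
  set s := √(N : ℝ) with hs
  have hN1 : (1 : ℝ) ≤ N := by exact_mod_cast hN
  have hN0 : (0 : ℝ) < N := by linarith
  have hs0 : 0 < s := Real.sqrt_pos.mpr hN0
  have hs1 : 1 ≤ s := Real.one_le_sqrt.mpr hN1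
  have hss : s * s = N := Real.mul_self_sqrt hN0.le
  have hB : 0 ≤ 2 * J * v / (g * l) := by positivity
  -- at `N = 1` the logarithm vanishes and only the trivial bound `p ≤ 1` is left
  rcases hN.eq_or_lt with hN1' | hN2
  · have hNr : (N : ℝ) = 1 := by rw [← hN1', Nat.cast_one]
    calc p * (2 * J * N) ≤ 1 * (2 * J * N) := by gcongr
      _ = 2 * J * 1 := by rw [hNr]; ring
      _ ≤ 2 * J * s + 2 * J * v / (g * l) * s := by
        have h1 : 2 * J * 1 ≤ 2 * J * s := by gcongr
        linarith [mul_nonneg hB hs0.le]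
      _ = _ := by ring
  · have hN2' : (2 : ℝ) ≤ N := by exact_mod_cast hN2
    have hls : l ≤ Real.log s := Real.log_le_log (by positivity) (Real.sqrt_le_sqrt hN2')
    have h1 : p * (g * l) * s * N ≤ v * N := by
      calc p * (g * l) * s * N = p * ((g * (l / s)) * N ^ 2) := by
            rw [← hss]; field_simp
        _ ≤ p * (u ^ 2 * N ^ 2) := by
            gcongr
            exact le_trans (by gcongr) hgap
        _ ≤ v * N := by rw [← mul_pow]; exact hcheb
    have hps : p * s ≤ v / (g * l) := by
      rw [le_div_iff₀ (by positivity)]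
      linarith [le_of_mul_le_mul_right h1 hN0]
    calc p * (2 * J * N) = 2 * J * s * (p * s) := by rw [← hss]; ring
      _ ≤ 2 * J * s * (v / (g * l)) := by gcongr
      _ ≤ _ := by
        have : 0 ≤ 2 * J * s := by positivity
        rw [add_mul, mul_div_assoc]
        linarith

/-- The sum of `|x j|` over a finite set on which `x` is not far below `0`, when `x` has cubic
tails on the scale `s`. -/
theorem sum_abs_le_of_cubic_tail {ι : Type*} [Fintype ι] {x : ι → ℝ} {s B c : ℝ} (hs : 0 < s)
    (hB : 0 ≤ B) (F : Finset ι) (hF : ∀ j ∈ F, -(B * s) ≤ x j) (hc0 : 0 ≤ c) (hc : c ≤ F.card)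
    (h : ∀ t : ℝ, 0 < t →
      ((Finset.univ.filter fun j => t * s ≤ x j).card : ℝ) ≤ 1 / t ^ 3 * c) :
    ∑ j ∈ F, |x j| ≤ (B + 3) * s * F.card := by
  have htail := sum_max_zero_le_of_cubic_tail (fun j => x j / s) F c hc0 fun t ht => by
    simpa only [le_div_iff₀ hs] using h t ht
  calc ∑ j ∈ F, |x j| ≤ ∑ j ∈ F, (s * max (x j / s) 0 + B * s) := by
        refine Finset.sum_le_sum fun j hj => ?_
        have h1 : s * (x j / s) = x j := by field_simp
        have h2 : s * (x j / s) ≤ s * max (x j / s) 0 := by gcongr; exact le_max_left _ _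
        have h3 : 0 ≤ s * max (x j / s) 0 := mul_nonneg hs.le (le_max_right _ _)
        have h4 := mul_nonneg hB hs.le
        exact abs_le.mpr ⟨by linarith [hF j hj], by linarith⟩
    _ = s * ∑ j ∈ F, max (x j / s) 0 + B * s * F.card := by
        rw [Finset.sum_add_distrib, ← Finset.mul_sum, Finset.sum_const, nsmul_eq_mul]
        ring
    _ ≤ s * (F.card + 2 * F.card) + B * s * F.card := by
        gcongr
        exact htail.trans (by linarith)
    _ = (B + 3) * s * F.card := by ring

theorem sum_mul_abs_le_of_sum_mul_sq_le {ι : Type*} [Fintype ι] {w x : ι → ℝ}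
    (hw : ∀ j, 0 ≤ w j) (hw1 : ∑ j, w j = 1) {v s : ℝ} (hs : 0 < s)
    (hx : ∑ j, w j * x j ^ 2 ≤ v * (s * s)) : ∑ j, w j * |x j| ≤ (v + 1) * s := by
  calc ∑ j, w j * |x j| ≤ ∑ j, (w j * x j ^ 2 / s + w j * s) := by
        refine Finset.sum_le_sum fun j _ => ?_
        rw [mul_div_assoc, ← mul_add]
        refine mul_le_mul_of_nonneg_left ?_ (hw j)
        rw [div_add' _ _ _ hs.ne', le_div_iff₀ hs, ← sq_abs]
        nlinarith [sq_nonneg (|x j| - s), sq_nonneg (|x j|), sq_nonneg s]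
    _ = (∑ j, w j * x j ^ 2) / s + s := by
        rw [Finset.sum_add_distrib, ← Finset.sum_div, ← Finset.sum_mul, hw1, one_mul]
    _ ≤ v * (s * s) / s + s := by gcongr
    _ = (v + 1) * s := by field_simp

theorem mainTheorem4 (D d r : ℕ) (J c₁ c₂ a b g : ℝ)
    (hc₁ : 0 < c₁) (ha : 0 < a) (hg : 0 < g) :
    ∃ C : ℝ, ∀ (n N : ℕ), 1 ≤ n → N = n ^ D →
      ∀ (h : Site D n → LatticeOp D n d) (H : LatticeOp D n d),
        IsLocalHamiltonian r J h → H = ∑ i, h i → SpectralDecay c₁ c₂ N H →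
      ∀ ψ : LatticeSpace D n d, IsProductState ψ →
      ∀ (η η' δ : ℝ) (K : ℕ),
        energy H ψ = η * N → c₁ ≤ η → η ≤ c₂ →
        a / √(N : ℝ) ≤ δ → δ ≤ b / √(N : ℝ) →
        1 ≤ K → η' = η - K * δ →
        g * (Real.log √(N : ℝ) / √(N : ℝ)) ≤ |η - η'| ^ 2 →
        |ensembleEnergy H (energyWindow N η η' δ K) ψ - energy H ψ| ≤ C * √(N : ℝ) := by
  classical
  -- `v` bounds the energy variance per site of a product state
  set v : ℝ := 4 * J ^ 2 * (4 * r + 1) ^ D with hv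
  have hv0 : 0 ≤ v := by positivity
  set l : ℝ := Real.log √2 with hl
  have hl0 : 0 < l := Real.log_pos (Real.lt_sqrt_of_sq_lt (by norm_num))
  -- the contributions of the top window, the bottom window, the first absolute moment of the
  -- energy distribution of `ψ`, and the width of the middle windows
  refine ⟨(b + 3) + (2 * J + 2 * J * v / (g * l)) + (v + 1) + b, ?_⟩
  intro n N hn hN h H hh hH hdecay ψ hψ η η' δ K hη hη1 hη2 hδa hδb hK hη' hgap
  have hψ1 := hψ.norm_eq_one
  have hJ : 0 ≤ J := (norm_nonneg _).trans (hh.norm_le fun _ => ⟨0, hn⟩)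
  have hN1 : (1 : ℝ) ≤ N := by
    have : 1 ≤ N := hN ▸ Nat.one_le_pow _ _ hn
    exact_mod_cast this
  have hN0 : (0 : ℝ) < N := by linarith
  set s : ℝ := √(N : ℝ) with hs
  have hs0 : 0 < s := Real.sqrt_pos.mpr hN0
  have hss : s * s = N := Real.mul_self_sqrt hN0.le
  have hδ : 0 < δ := (div_pos ha hs0).trans_le hδa
  have hδN : δ * N ≤ b * s := by
    have := (le_div_iff₀ hs0).mp hδb
    rw [← hss]
    nlinarith
  have hHsa : IsSelfAdjoint H := by
    rw [hH]
    exact isSelfAdjoint_sum (R := LatticeOp D n d) _ fun i _ => hh.selfAdjoint i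
  have hHn : ‖H‖ ≤ J * N := by
    rw [hH]
    refine (norm_sum_le_of_le _ fun i _ => hh.norm_le i).trans ?_
    rw [Finset.sum_const, nsmul_eq_mul, Finset.card_univ, card_site, ← hN, mul_comm]
  -- an eigenbasis, the weights of `ψ` in it, and the eigenvalues relative to the mean energy
  set e := hHsa.isSymmetric.eigenvectorBasis rfl with he_def
  set lam := hHsa.isSymmetric.eigenvalues rfl with hlam
  have he : ∀ j, H (e j) = (lam j : ℂ) • e j := fun j =>
    hHsa.isSymmetric.apply_eigenvectorBasis rfl j
  set w : _ → ℝ := fun j => ‖inner ℂ (e j) ψ‖ ^ 2 with hw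
  set x : _ → ℝ := fun j => lam j - η * N with hx
  have hw0 : ∀ j, 0 ≤ w j := fun j => by positivity
  have hw1 : ∑ j, w j = 1 := by rw [hw, e.sum_sq_norm_inner_right, hψ1, one_pow]
  have hvar : ∑ j, w j * x j ^ 2 ≤ v * N := by
    have := normSq_sub_energy_smul_le hh hψ
    rw [← hH, hη, normSq_sub_smul_eq_sum_of_eigenbasis e he] at this
    rw [hN]
    push_cast
    exact this
  choose κ hκ using fun j => exists_energyWindow_index hN0 hδ hK hη' (lam j)
  have hκ0 : ∀ j, κ j = 0 ↔ (η - δ) * N ≤ lam j := fun j => by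
    rw [← hκ j 0]; simp [energyWindow]
  have hens := ensembleEnergy_eq_fiberAverage e he hκ ψ
  have hsplit : fiberAverage κ w lam = fiberAverage κ w x + η * N := by
    have := fiberAverage_add κ w x fun _ => η * N
    rw [fiberAverage_const, hw1, one_mul] at this
    simpa [hx] using this
  rw [hens, hη, hsplit, add_sub_cancel_right]
  have hb : 0 ≤ b := by
    by_contra! hb
    nlinarith [mul_pos hδ hN0]
  have hfirst : |∑ j with κ j = 0, x j| ≤
      (b + 3) * s * (Finset.univ.filter fun i => κ i = 0).card := by
    have hnum : ∀ E, numEigenstatesGE H E = (Finset.univ.filter fun j => E ≤ lam j).card :=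
      fun E => by
        rw [numEigenstatesGE, finrank_spectralSubspace e he]; simp only [Set.mem_Ici]
    refine (Finset.abs_sum_le_sum_abs _ _).trans
      (sum_abs_le_of_cubic_tail (c := numEigenstatesGE H (η * N)) hs0 hb _ ?_
        (Nat.cast_nonneg _) ?_ ?_)
    · intro j hj
      have := (hκ0 j).mp (Finset.mem_filter.mp hj).2
      simp only [hx]
      linarith
    · rw [hnum]
      refine Nat.cast_le.mpr (Finset.card_le_card fun j hj => ?_)
      rw [Finset.mem_filter] at hj ⊢
      exact ⟨hj.1, (hκ0 j).mpr (by linarith [hj.2, mul_pos hδ hN0])⟩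
    · intro t ht
      have := hdecay (η * N) (by gcongr) (by gcongr) t ht
      rw [hnum (η * N + t * _)] at this
      simpa only [hx, le_sub_iff_add_le'] using this
  have hlast : ∀ j, κ j = Fin.last K → (∑ i with κ i = Fin.last K, w i) * |x j| ≤
      (2 * J + 2 * J * v / (g * l)) * s := by
    intro j _
    set p : ℝ := ∑ i with κ i = Fin.last K, w i with hp
    have hp0 : 0 ≤ p := Finset.sum_nonneg fun i _ => hw0 i
    have hp1 : p ≤ 1 := hw1 ▸ Finset.sum_le_univ_sum_of_nonneg hw0
    have hxj : |x j| ≤ 2 * J * N := by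
      have h1 := (abs_eigenvalue_le_norm e he j).trans hHn
      have h2 := (abs_energy_le H hψ1).trans hHn
      rw [hη] at h2
      have := abs_sub (lam j) (η * N)
      simp only [hx]
      linarith
    refine (mul_le_mul_of_nonneg_left hxj hp0).trans
      (weight_mul_extensive_le (u := η - η') (by exact_mod_cast hN1) hp0 hp1 hv0 hg hJ ?_
        (by rwa [sq_abs] at hgap))
    -- Chebyshev: the last window lies at distance `(η - η') N` below the mean energy
    refine (sum_mul_sq_le_of_le_neg hw0 ?_ _ fun i hi => ?_).trans hvar
    · rw [hη', sub_sub_cancel]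
      positivity
    · have hi' := (hκ i (Fin.last K)).mpr (Finset.mem_filter.mp hi).2
      simp only [energyWindow, Fin.val_last, if_neg (show K ≠ 0 by omega), if_true,
        Set.mem_Iio] at hi'
      simp only [hx]
      linarith
  have hmid : ∀ i j, κ i = κ j → κ i ≠ 0 → κ i ≠ Fin.last K → |x j| ≤ |x i| + b * s := by
    intro i j hij h0 h1
    have hi := (hκ i (κ i)).mpr rfl
    have hj := (hκ j (κ i)).mpr hij.symm
    have h0' : ((κ i : Fin (K + 1)) : ℕ) ≠ 0 := fun hc => h0 (Fin.ext hc)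
    have h1' : ((κ i : Fin (K + 1)) : ℕ) ≠ K := fun hc => h1 (Fin.ext hc)
    simp only [energyWindow, if_neg h0', if_neg h1', Set.mem_Ico] at hi hj
    have hd : |x j - x i| ≤ b * s := by
      simp only [hx]
      exact abs_le.mpr ⟨by linarith, by linarith⟩
    have := abs_sub_abs_le_abs_sub (x j) (x i)
    linarith
  have hmoment := sum_mul_abs_le_of_sum_mul_sq_le hw0 hw1 hs0 (hss ▸ hvar)
  have hbs : 0 ≤ b * s := mul_nonneg hb hs0.le
  have := abs_fiberAverage_le κ w x 0 (Fin.last K) ((b + 3) * s)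
    ((2 * J + 2 * J * v / (g * l)) * s) (b * s) (by positivity) (by positivity) hbs hw0 hw1
    hfirst hlast hmid
  linarith
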